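/- Let $n\ge 1$ be an integer and $a>0$. Let $X_1,X_2$ be independent random points, each uniformly distributed in a ball of radius $a$ in $\mathbb R^n$ (with the Euclidean norm), and let $D=|X_1-X_2|$. Put $$C=\frac{n\,\Gamma(n+1)}{\Gamma\left(\frac n2+\frac12\right)},\qquad C'=\sqrt{\pi}\,2^{-n}C.$$ (i) $D/(2a)$ has a density on $(0,1)$ given by $$f_n(\lambda)=\frac{2n\,\Gamma(n+1)\,\lambda^{n-1}}{\Gamma\left(\frac n2+\frac12\right)^2}\int_\lambda^1(1-z^2)^{(n-1)/2}\,dz .$$ (ii) For $s\in\mathbb C$, the variable $D^s$ is integrable if and only if $\operatorname{Re}s>-n$, and in that case $$\mathbb E\,(D/2a)^s=\frac{n\,\Gamma(n+1)}{\Gamma\left(\frac n2+\frac12\right)}\cdot\frac{\Gamma\left(\frac n2+\frac s2+\frac12\right)}{(n+s)\,\Gamma\left(n+\frac s2+1\right)},$$ $$\mathbb E\,D^s=C(2a)^s\frac{\Gamma(s+n)\,\Gamma\left(\frac s2+\frac n2+\frac12\right)}{\Gamma(s+n+1)\,\Gamma\left(\frac s2+n+1\right)}=C'a^s\frac{\Gamma(s+n)}{\Gamma\left(\frac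 s2+\frac n2+1\right)\Gamma\left(\frac s2+n+1\right)} .$$ (iii) Let $B_{\alpha,\beta}$ denote a random variable with the Beta distribution with parameters $\alpha,\beta$. If $B_{n,1}$ and $B_{(n+1)/2,(n+1)/2}$ are independent, then $D$ has the same distribution as $2a\,B_{n,1}\,B_{(n+1)/2,(n+1)/2}^{1/2}$. Likewise, if $U$ is uniform on $(0,1)$ and independent of $B_{(n+1)/2,(n+1)/2}$, then $D$ has the same distribution as $2a\,U^{1/n}\,B_{(n+1)/2,(n+1)/2}^{1/2}$. (iv) If $n=2$, then $\mathbb E D=\frac{128}{45\pi}a$. If $a=\frac12$, then: for $n=1$, $\mathbb E D=\frac13$ and $\mathbb E D^2=\frac16$; for $n=2$, $\mathbb E D=\frac{64}{45\pi}$ and $\mathbb E D^2=\frac14$; for $n=3$, $\mathbb E D=\frac{18}{35}$ and $\mathbb E D^2=\frac{3}{10}$. For all $n$ and $a$, $\mathbb E D^2=\frac{2a^2n}{n+2}$. -/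

import Mathlib

open MeasureTheory ProbabilityTheory

noncomputable section

/-- The normalising constant `C = n Γ(n+1) / Γ(n/2 + 1/2)`. -/
def ballDistConst (n : ℕ) : ℝ :=
  n * Real.Gamma (n + 1) / Real.Gamma ((n : ℝ) / 2 + 1 / 2)

/-- The function
`f_n(l) = 2 n Γ(n+1) l^(n-1) / Γ(n/2 + 1/2)^2 * ∫_l^1 (1 - z^2)^((n-1)/2) dz` (for `0 < l < 1`). -/
def ballDistDensity (n : ℕ) (l : ℝ) : ℝ :=
  2 * n * Real.Gamma (n + 1) * l ^ ((n : ℝ) - 1) / Real.Gamma ((n : ℝ) / 2 + 1 / 2) ^ 2 *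
    ∫ z in l..1, (1 - z ^ 2) ^ (((n : ℝ) - 1) / 2)

end

/-! Write the points as `c + a(w + u)` and `c + a(w - u)`. Both lie in the ball exactly when `w`
lies in the lens cut out by the unit balls centred at `u` and `-u`, and `D/(2a) = ‖u‖`. So `u` has
density proportional to the volume of its lens. Slicing perpendicular to `u` (`volume_lens`) and
passing to polar coordinates (`lintegral_fun_norm_eq`) gives `D/(2a)` a density proportional to `r^m
∫_r^1 (1 - t^2)^(m/2) dt`, with `m = n - 1` (`exists_lintegral_dist_div_eq`).

The product `B₁ √B₂` has a density of the same shape: `Z = √B₂` has density proportional to `z^n (1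
- z^2)^(m/2)`, and given `Z = z` the product has density `n l^m / z^n` on `(0, z)`. The powers of
`z` cancel, and integrating out `z > l` leaves the same integral
(`lintegral_betaMeasure_prod_comp_mul_sqrt`). Both laws are probability measures, so the constants
agree and the geometric one is never evaluated (`hasLaw_dist_div`).

The moments are then products of Beta moments. The two forms for `E D^s` differ by Legendre's
duplication formula. -/

/-- A Euclidean space splits as a line through a given vector and an orthogonal complement. -/
theorem exists_linearIsometryEquiv_prod_apply_eq {E F : Type*} [NormedAddCommGroup E]
    [InnerProductSpace ℝ E] [FiniteDimensional ℝ E] [NormedAddCommGroup F] [InnerProductSpace ℝ F]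
    [FiniteDimensional ℝ F]
    (hdim : Module.finrank ℝ E = Module.finrank ℝ F + 1) (u : E) :
    ∃ φ : WithLp 2 (ℝ × F) ≃ₗᵢ[ℝ] E, φ (WithLp.toLp 2 (‖u‖, 0)) = u := by
  have h : Module.finrank ℝ (WithLp 2 (ℝ × F)) = Module.finrank ℝ E := by
    rw [(WithLp.linearEquiv 2 ℝ (ℝ × F)).finrank_eq, Module.finrank_prod, hdim,
      Module.finrank_self, add_comm]
  let e : WithLp 2 (ℝ × F) ≃ₗᵢ[ℝ] E :=
    (stdOrthonormalBasis ℝ (WithLp 2 (ℝ × F))).equiv (stdOrthonormalBasis ℝ E) (finCongr h)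
  have hn : ‖e (WithLp.toLp 2 (‖u‖, (0 : F)))‖ = ‖u‖ := by
    rw [e.norm_map, ← sq_eq_sq₀ (norm_nonneg _) (norm_nonneg _), WithLp.prod_norm_sq_eq_of_L2]
    simp
  -- Vectors of equal norm are exchanged by reflection in the hyperplane orthogonal to their
  -- difference.
  exact ⟨e.trans (Submodule.reflection (ℝ ∙ (e (WithLp.toLp 2 (‖u‖, (0 : F))) - u))ᗮ),
    Submodule.reflection_sub hn⟩

/-! ### Polar coordinates and the volume of the lens. -/

section Geometry

variable {E F : Type*} [NormedAddCommGroup E] [InnerProductSpace ℝ E] [FiniteDimensional ℝ E]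
  [MeasurableSpace E] [BorelSpace E]
  [NormedAddCommGroup F] [InnerProductSpace ℝ F] [FiniteDimensional ℝ F]
  [MeasurableSpace F] [BorelSpace F]

/-- Integration of a radial function in polar coordinates. -/
theorem lintegral_fun_norm_eq (μ : Measure E) [μ.IsAddHaarMeasure] [Nontrivial E]
    {f : ℝ → ENNReal} (hf : Measurable f) :
    ∫⁻ x, f ‖x‖ ∂μ = μ.toSphere Set.univ *
      ∫⁻ r in Set.Ioi (0 : ℝ), ENNReal.ofReal (r ^ (Module.finrank ℝ E - 1)) * f r := by
  have h1 : ∫⁻ x, f ‖x‖ ∂μ = ∫⁻ x : ({(0 : E)}ᶜ : Set E), f ‖x.1‖ ∂(μ.comap (↑)) := by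
    rw [lintegral_subtype_comap (measurableSet_singleton _).compl (fun x => f ‖x‖),
      restrict_compl_singleton]
  rw [h1]
  have h2 := μ.measurePreserving_homeomorphUnitSphereProd.lintegral_comp
    (f := fun p => f p.2.1) (by fun_prop)
  simp only [homeomorphUnitSphereProd_apply_snd_coe] at h2
  rw [h2, lintegral_prod _ (by fun_prop)]
  simp only [lintegral_const]
  rw [mul_comm, Measure.volumeIoiPow, lintegral_withDensity_eq_lintegral_mul _ (by fun_prop)
    (by fun_prop)]
  congr 1
  exact lintegral_subtype_comap measurableSet_Ioi
    (fun r => ENNReal.ofReal (r ^ (Module.finrank ℝ E - 1)) * f r)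

theorem lintegral_fun_abs_eq (f : ℝ → ENNReal) :
    ∫⁻ t : ℝ, f |t| = 2 * ∫⁻ t in Set.Ioi (0 : ℝ), f t := by
  have hneg : ∫⁻ t in Set.Iic (0 : ℝ), f |t| = ∫⁻ t in Set.Ioi (0 : ℝ), f t := by
    rw [setLIntegral_congr Iio_ae_eq_Iic.symm,
      ← (Measure.measurePreserving_neg (volume : Measure ℝ)).setLIntegral_comp_preimage_emb
      (MeasurableEquiv.neg ℝ).measurableEmbedding]
    simp only [abs_neg, Set.neg_preimage, Set.neg_Iio, neg_zero]
    exact setLIntegral_congr_fun measurableSet_Ioi fun t ht => by rw [abs_of_pos ht]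
  rw [← lintegral_add_compl _ (measurableSet_Iic (a := (0 : ℝ))), hneg, Set.compl_Iic, two_mul]
  congr 1
  exact setLIntegral_congr_fun measurableSet_Ioi fun t ht => by rw [abs_of_pos ht]

theorem setLIntegral_Ioi_comp_add (f : ℝ → ENNReal) (r : ℝ) :
    ∫⁻ t in Set.Ioi (0 : ℝ), f (t + r) = ∫⁻ t in Set.Ioi r, f t := by
  rw [← (measurePreserving_add_right (volume : Measure ℝ) r).setLIntegral_comp_preimage_emb
    (MeasurableEquiv.addRight r).measurableEmbedding f (Set.Ioi r)]
  simp

/-- Slices of the unit ball are balls of radius `√(1 - z ^ 2)`. The indicator matters in dimension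
zero, where `√(1 - z ^ 2) ^ 0 = 1` even for `z > 1`. -/
theorem volume_setOf_sq_add_norm_sq_le_one {z : ℝ} (hz : 0 ≤ z) :
    volume {y : F | z ^ 2 + ‖y‖ ^ 2 ≤ 1} =
      (Set.Iic (1 : ℝ)).indicator (fun z => volume (Metric.ball (0 : F) 1) *
        ENNReal.ofReal (√(1 - z ^ 2) ^ Module.finrank ℝ F)) z := by
  by_cases h1 : z ≤ 1
  · rw [Set.indicator_of_mem (Set.mem_Iic.2 h1), mul_comm,
      ← Measure.addHaar_closedBall _ (0 : F) (Real.sqrt_nonneg _)]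
    congr 1
    ext y
    rw [Set.mem_ofPred_eq, mem_closedBall_zero_iff, Real.le_sqrt (norm_nonneg _) (by nlinarith)]
    constructor <;> intro h <;> linarith
  · rw [Set.indicator_of_notMem (by simpa using h1)]
    convert measure_empty (μ := (volume : Measure F))
    ext y
    simp only [Set.mem_ofPred_eq, Set.mem_empty_iff_false, iff_false, not_le]
    nlinarith [sq_nonneg ‖y‖]

/-- The volume of the intersection of two unit balls with centres `u` and `-u`. -/
theorem volume_lens (hdim : Module.finrank ℝ E = Module.finrank ℝ F + 1) (u : E) :
    volume {w : E | ‖w + u‖ ≤ 1 ∧ ‖w - u‖ ≤ 1} =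
      2 * volume (Metric.ball (0 : F) 1) *
        ∫⁻ t in Set.Ioc ‖u‖ 1, ENNReal.ofReal (√(1 - t ^ 2) ^ Module.finrank ℝ F) := by
  obtain ⟨φ, hφ⟩ := exists_linearIsometryEquiv_prod_apply_eq (F := F) hdim u
  have hmp : MeasurePreserving (fun p : ℝ × F => φ (WithLp.toLp 2 p)) volume volume :=
    φ.measurePreserving.comp (WithLp.volume_preserving_toLp ℝ F)
  have hmeas : MeasurableSet {w : E | ‖w + u‖ ≤ 1 ∧ ‖w - u‖ ≤ 1} :=
    MeasurableSet.inter (s₁ := {w : E | ‖w + u‖ ≤ 1}) (s₂ := {w : E | ‖w - u‖ ≤ 1})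
      (measurableSet_le (by fun_prop) (by fun_prop)) (measurableSet_le (by fun_prop) (by fun_prop))
  have hnorm (p : ℝ × F) (s : ℝ) :
      ‖φ (WithLp.toLp 2 p) + s • u‖ ^ 2 = (p.1 + s * ‖u‖) ^ 2 + ‖p.2‖ ^ 2 := by
    conv_lhs => rw [← hφ]
    rw [← map_smul, ← map_add, φ.norm_map, WithLp.prod_norm_sq_eq_of_L2]
    simp
  -- Along `u` the two conditions read `(p.1 ± ‖u‖) ^ 2 + ‖p.2‖ ^ 2 ≤ 1`; the binding one has the
  -- sign of `p.1`.
  have hpre : (fun p : ℝ × F => φ (WithLp.toLp 2 p)) ⁻¹' {w : E | ‖w + u‖ ≤ 1 ∧ ‖w - u‖ ≤ 1} =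
      {p : ℝ × F | (|p.1| + ‖u‖) ^ 2 + ‖p.2‖ ^ 2 ≤ 1} := by
    ext p
    have h1 := hnorm p 1
    have h2 := hnorm p (-1)
    simp only [one_smul, one_mul, neg_smul, ← sub_eq_add_neg, neg_mul] at h1 h2
    simp only [Set.mem_preimage, Set.mem_ofPred_eq]
    rw [← sq_le_one_iff₀ (norm_nonneg (_ + u)), ← sq_le_one_iff₀ (norm_nonneg (_ - u)), h1, h2]
    rcases abs_cases p.1 with ⟨h, h0⟩ | ⟨h, h0⟩ <;> rw [h] <;> constructor
    · exact fun h => h.1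
    · exact fun h => ⟨h, by nlinarith [mul_nonneg h0 (norm_nonneg u)]⟩
    · exact fun h => by nlinarith
    · exact fun h => ⟨by nlinarith [mul_nonneg (neg_pos.2 h0).le (norm_nonneg u)], by nlinarith⟩
  have hmeas2 : MeasurableSet {p : ℝ × F | (|p.1| + ‖u‖) ^ 2 + ‖p.2‖ ^ 2 ≤ 1} :=
    hpre ▸ hmp.measurable hmeas
  rw [← hmp.measure_preimage hmeas.nullMeasurableSet, hpre, Measure.volume_eq_prod,
    Measure.prod_apply hmeas2]
  have hslice (t : ℝ) : volume (Prod.mk t ⁻¹' {p : ℝ × F | (|p.1| + ‖u‖) ^ 2 + ‖p.2‖ ^ 2 ≤ 1}) =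
      (Set.Iic (1 : ℝ)).indicator (fun z => volume (Metric.ball (0 : F) 1) *
        ENNReal.ofReal (√(1 - z ^ 2) ^ Module.finrank ℝ F)) (|t| + ‖u‖) :=
    volume_setOf_sq_add_norm_sq_le_one (add_nonneg (abs_nonneg t) (norm_nonneg u))
  simp_rw [hslice]
  -- Symmetry in `t` gives the factor 2; shifting by `‖u‖` moves the lower limit there, and the
  -- indicator stops the integral at 1.
  rw [lintegral_fun_abs_eq (fun t => (Set.Iic (1 : ℝ)).indicator
      (fun z => volume (Metric.ball (0 : F) 1) *
        ENNReal.ofReal (√(1 - z ^ 2) ^ Module.finrank ℝ F)) (t + ‖u‖)),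
    setLIntegral_Ioi_comp_add, setLIntegral_indicator measurableSet_Iic, mul_assoc,
    Set.inter_comm, Set.Ioi_inter_Iic, lintegral_const_mul' _ _ measure_ball_lt_top.ne]

end Geometry

/-! ### The distance law up to a constant. -/

section BallLaw

variable {E F : Type*} [NormedAddCommGroup E] [InnerProductSpace ℝ E] [FiniteDimensional ℝ E]
  [MeasurableSpace E] [BorelSpace E]
  [NormedAddCommGroup F] [InnerProductSpace ℝ F] [FiniteDimensional ℝ F]
  [MeasurableSpace F] [BorelSpace F]

theorem lintegral_eq_mul_lintegral_comp_add_smul {b : ℝ} (hb : b ≠ 0) {f : E → ENNReal}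
    (hf : Measurable f) (p : E) :
    ∫⁻ x, f x = ENNReal.ofReal |b ^ Module.finrank ℝ E| * ∫⁻ w, f (p + b • w) := by
  have h := lintegral_map (μ := (volume : Measure E)) (f := fun x => f (p + x)) (g := fun w => b • w)
    (by fun_prop) (by fun_prop)
  rw [← h, Measure.map_addHaar_smul _ hb, lintegral_smul_measure, smul_eq_mul, ← mul_assoc,
    ← ENNReal.ofReal_mul (abs_nonneg _), ← abs_mul, mul_inv_cancel₀ (pow_ne_zero _ hb), abs_one,
    ENNReal.ofReal_one, one_mul, lintegral_add_left_eq_self]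

/-- The integral is antitone in its lower limit, so `h` need not be measurable. -/
theorem measurable_setLIntegral_Ioc (h : ℝ → ENNReal) (b : ℝ) :
    Measurable fun r => ∫⁻ t in Set.Ioc r b, h t :=
  Antitone.measurable fun _ _ hxy => lintegral_mono_set (Set.Ioc_subset_Ioc_left hxy)

/-- Up to a constant factor, the law of the normalised distance between two independent uniform
points of a ball. -/
theorem exists_lintegral_dist_div_eq (hdim : Module.finrank ℝ E = Module.finrank ℝ F + 1)
    {Ω : Type*} [MeasurableSpace Ω] (P : Measure Ω) [IsProbabilityMeasure P]
    {a : ℝ} (ha : 0 < a) (c : E) {X₁ X₂ : Ω → E}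
    (hX₁ : pdf.IsUniform X₁ (Metric.closedBall c a) P volume)
    (hX₂ : pdf.IsUniform X₂ (Metric.closedBall c a) P volume)
    (hm₁ : AEMeasurable X₁ P) (hm₂ : AEMeasurable X₂ P) (hind : IndepFun X₁ X₂ P) :
    ∃ k : ENNReal, ∀ g : ℝ → ENNReal, Measurable g →
      ∫⁻ ω, g (dist (X₁ ω) (X₂ ω) / (2 * a)) ∂P =
        k * ∫⁻ r in Set.Ioi (0 : ℝ), ENNReal.ofReal (r ^ Module.finrank ℝ F) * (g r *
          ∫⁻ t in Set.Ioc r 1, ENNReal.ofReal (√(1 - t ^ 2) ^ Module.finrank ℝ F)) := by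
  have : Nontrivial E := Module.nontrivial_of_finrank_pos (R := ℝ) (by omega)
  set S : Set E := Metric.closedBall c a with hS
  have hSm : MeasurableSet S := Metric.isClosed_closedBall.measurableSet
  set κ : ENNReal := (volume S)⁻¹
  set m := Module.finrank ℝ F with hm
  set v := volume (Metric.ball (0 : F) 1)
  set q : E → ENNReal := S.indicator 1 with hq
  have hqm : Measurable q := measurable_one.indicator hSm
  -- The factors are the two uniform densities, the two Jacobians, the lens constant and the
  -- sphere's total mass. Only independence of `g` matters later.
  refine ⟨κ * κ * (ENNReal.ofReal |(-(2 * a)) ^ Module.finrank ℝ E| *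
    ENNReal.ofReal |a ^ Module.finrank ℝ E|) *
      (2 * v * (volume : Measure E).toSphere Set.univ), fun g hg => ?_⟩
  have hX : HasLaw (fun ω => (X₁ ω, X₂ ω))
      ((cond volume S : Measure E).prod (cond volume S)) P :=
    (indepFun_iff_hasLaw_prodMk_prod ⟨hm₁, hX₁⟩ ⟨hm₂, hX₂⟩).1 hind
  have hcond (f : E → ENNReal) :
      ∫⁻ x, f x ∂(cond volume S) = κ * ∫⁻ x, q x * f x := by
    rw [ProbabilityTheory.cond, lintegral_smul_measure, smul_eq_mul, ← lintegral_indicator hSm]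
    congr 2 with x
    by_cases hx : x ∈ S <;> simp [hq, hx]
  have hgm : Measurable fun p : E × E => g (dist p.1 p.2 / (2 * a)) := by fun_prop
  set lens : E → Set E := fun u => {w : E | ‖w + u‖ ≤ 1 ∧ ‖w - u‖ ≤ 1} with hlens
  have hlm (u : E) : MeasurableSet (lens u) :=
    MeasurableSet.inter (s₁ := {w : E | ‖w + u‖ ≤ 1}) (s₂ := {w : E | ‖w - u‖ ≤ 1})
      (measurableSet_le (by fun_prop) (by fun_prop)) (measurableSet_le (by fun_prop) (by fun_prop))
  have hpt (u w : E) : q (c + a • u + a • w) * (q (c + a • u + a • w + -(2 * a) • u) *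
      g (dist (c + a • u + a • w) (c + a • u + a • w + -(2 * a) • u) / (2 * a))) =
      (lens u).indicator (fun _ => g ‖u‖) w := by
    have e1 : c + a • u + a • w = c + a • (w + u) := by module
    have e2 : c + a • u + a • w + -(2 * a) • u = c + a • (w - u) := by module
    have e3 (y : E) : c + a • y ∈ S ↔ ‖y‖ ≤ 1 := by
      rw [hS, Metric.mem_closedBall, dist_self_add_left, norm_smul, Real.norm_of_nonneg ha.le,
        mul_le_iff_le_one_right ha]
    have e4 : dist (c + a • (w + u)) (c + a • (w - u)) / (2 * a) = ‖u‖ := by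
      have : a • (w + u) - a • (w - u) = (2 * a) • u := by module
      rw [dist_add_left, dist_eq_norm, this, norm_smul, Real.norm_of_nonneg (by positivity)]
      field_simp
    have e5 (y : E) : q (c + a • y) = if ‖y‖ ≤ 1 then 1 else 0 := by
      by_cases hy : ‖y‖ ≤ 1
      · rw [if_pos hy, hq, Set.indicator_of_mem ((e3 y).2 hy), Pi.one_apply]
      · rw [if_neg hy, hq, Set.indicator_of_notMem (fun h => hy ((e3 y).1 h))]
    rw [e2, e1, e4, e5, e5]
    by_cases h1 : ‖w + u‖ ≤ 1 <;> by_cases h2 : ‖w - u‖ ≤ 1 <;> simp [hlens, h1, h2]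
  -- Substitute `y = x - 2a u` at fixed `x`, swap the integrals, then substitute `x = c + a u + a w`
  -- at fixed `u`.
  have hsubst : ∫⁻ x, ∫⁻ y, q x * (q y * g (dist x y / (2 * a))) =
      ENNReal.ofReal |(-(2 * a)) ^ Module.finrank ℝ E| *
        (ENNReal.ofReal |a ^ Module.finrank ℝ E| * ∫⁻ u, g ‖u‖ * volume (lens u)) := by
    have h1 (x : E) := lintegral_eq_mul_lintegral_comp_add_smul (b := -(2 * a)) (by simp [ha.ne'])
      (f := fun y => q x * (q y * g (dist x y / (2 * a)))) (by fun_prop) x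
    simp_rw [h1]
    rw [lintegral_const_mul' _ _ ENNReal.ofReal_ne_top, lintegral_lintegral_swap (by fun_prop)]
    have h2 (u : E) := lintegral_eq_mul_lintegral_comp_add_smul ha.ne'
      (f := fun x => q x * (q (x + -(2 * a) • u) * g (dist x (x + -(2 * a) • u) / (2 * a))))
      (by fun_prop) (c + a • u)
    simp_rw [h2]
    rw [lintegral_const_mul' _ _ ENNReal.ofReal_ne_top]
    congr 3 with u
    simp_rw [hpt, lintegral_indicator_const (hlm u)]
  have hint := measurable_setLIntegral_Ioc (fun t => ENNReal.ofReal (√(1 - t ^ 2) ^ m)) 1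
  rw [hX.lintegral_comp (f := fun p => g (dist p.1 p.2 / (2 * a))) hgm.aemeasurable,
    lintegral_prod _ hgm.aemeasurable, hcond]
  simp_rw [hcond]
  have h3 (x : E) : q x * (κ * ∫⁻ y, q y * g (dist x y / (2 * a))) =
      κ * ∫⁻ y, q x * (q y * g (dist x y / (2 * a))) := by
    rw [lintegral_const_mul _ (by fun_prop)]; ring
  simp_rw [h3]
  rw [lintegral_const_mul _ (by fun_prop), hsubst]
  simp_rw [hlens, volume_lens (F := F) hdim]
  rw [lintegral_fun_norm_eq volume (f := fun r => g r * (2 * v *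
    ∫⁻ t in Set.Ioc r 1, ENNReal.ofReal (√(1 - t ^ 2) ^ m))) (by fun_prop)]
  have h4 (r : ℝ) : ENNReal.ofReal (r ^ (Module.finrank ℝ E - 1)) * (g r * (2 * v *
      ∫⁻ t in Set.Ioc r 1, ENNReal.ofReal (√(1 - t ^ 2) ^ m))) = (2 * v) *
      (ENNReal.ofReal (r ^ m) * (g r *
        ∫⁻ t in Set.Ioc r 1, ENNReal.ofReal (√(1 - t ^ 2) ^ m))) := by
    rw [hdim, Nat.add_sub_cancel]; ring
  simp_rw [h4]
  rw [lintegral_const_mul _ (by fun_prop)]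
  ring

end BallLaw

/-! ### The law and density of `B₁ √B₂`. -/

section BetaLaw

theorem lintegral_betaMeasure (α β : ℝ) {f : ℝ → ENNReal} (hf : Measurable f) :
    ∫⁻ x, f x ∂(betaMeasure α β) = ∫⁻ x in Set.Ioo (0 : ℝ) 1,
      ENNReal.ofReal (1 / beta α β * x ^ (α - 1) * (1 - x) ^ (β - 1)) * f x := by
  rw [betaMeasure, lintegral_withDensity_eq_lintegral_mul volume
    (f := betaPDF α β) (measurable_betaPDFReal α β).ennreal_ofReal hf,
    ← lintegral_indicator measurableSet_Ioo]
  congr 1 with x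
  by_cases hx : x ∈ Set.Ioo (0 : ℝ) 1
  · simp [hx, betaPDF_of_pos_lt_one hx.1 hx.2]
  · have : betaPDF α β x = 0 := by
      rw [betaPDF_eq, if_neg (fun h => hx ⟨h.1, h.2⟩), ENNReal.ofReal_zero]
    simp [hx, this]

/-- Tonelli's theorem on the triangle `0 < l < z < 1`. -/
theorem lintegral_triangle {A B : ℝ → ENNReal} (hA : Measurable A) (hB : Measurable B) :
    ∫⁻ z in Set.Ioo (0 : ℝ) 1, A z * ∫⁻ l in Set.Ioo 0 z, B l =
      ∫⁻ l in Set.Ioi (0 : ℝ), B l * ∫⁻ z in Set.Ioc l 1, A z := by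
  have hT : MeasurableSet {p : ℝ × ℝ | 0 < p.2 ∧ p.2 < p.1 ∧ p.1 < 1} :=
    (measurableSet_lt measurable_const measurable_snd).inter
      ((measurableSet_lt measurable_snd measurable_fst).inter
        (measurableSet_lt measurable_fst measurable_const))
  set T := {p : ℝ × ℝ | 0 < p.2 ∧ p.2 < p.1 ∧ p.1 < 1} with hTdef
  have h1 : ∫⁻ z in Set.Ioo (0 : ℝ) 1, A z * ∫⁻ l in Set.Ioo 0 z, B l =
      ∫⁻ z, ∫⁻ l, T.indicator (fun p => A p.1 * B p.2) (z, l) := by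
    rw [← lintegral_indicator measurableSet_Ioo]
    congr 1 with z
    by_cases hz : z ∈ Set.Ioo (0 : ℝ) 1
    · rw [Set.indicator_of_mem hz, ← lintegral_const_mul _ hB,
        ← lintegral_indicator measurableSet_Ioo]
      congr 1 with l
      simp [Set.indicator_apply, hTdef, hz.2]
    · rw [Set.indicator_of_notMem hz]
      symm
      refine (lintegral_eq_zero_iff' (by fun_prop)).2 (.of_forall fun l => ?_)
      refine Set.indicator_of_notMem (fun h => hz ⟨h.1.trans h.2.1, h.2.2⟩) _
  have h2 : ∫⁻ l in Set.Ioi (0 : ℝ), B l * ∫⁻ z in Set.Ioc l 1, A z =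
      ∫⁻ l, ∫⁻ z, T.indicator (fun p => A p.1 * B p.2) (z, l) := by
    rw [← lintegral_indicator measurableSet_Ioi]
    congr 1 with l
    by_cases hl : l ∈ Set.Ioi (0 : ℝ)
    · rw [Set.indicator_of_mem hl, setLIntegral_congr Ioo_ae_eq_Ioc.symm,
        ← lintegral_const_mul _ hA, ← lintegral_indicator measurableSet_Ioo]
      congr 1 with z
      simp [Set.indicator_apply, hTdef, Set.mem_Ioi.1 hl, mul_comm]
    · rw [Set.indicator_of_notMem hl]
      symm
      refine (lintegral_eq_zero_iff' (by fun_prop)).2 (.of_forall fun z => ?_)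
      refine Set.indicator_of_notMem (fun h => hl h.1) _
  rw [h1, h2, lintegral_lintegral_swap]
  exact (Measurable.indicator (by fun_prop) hT).aemeasurable

/-- The case `k = 2` removes the square root of `B₂`; `k = n` turns a uniform variable into a Beta
one. -/
theorem setLIntegral_Ioo_comp_pow {k : ℕ} (hk : k ≠ 0) (f : ℝ → ENNReal) :
    ∫⁻ y in Set.Ioo (0 : ℝ) 1, f y =
      ∫⁻ z in Set.Ioo (0 : ℝ) 1, ENNReal.ofReal (k * z ^ (k - 1)) * f (z ^ k) := by
  have himg : (fun z : ℝ => z ^ k) '' Set.Ioo 0 1 = Set.Ioo 0 1 := by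
    ext y
    constructor
    · rintro ⟨z, hz, rfl⟩
      exact ⟨pow_pos hz.1 k, pow_lt_one₀ hz.1.le hz.2 hk⟩
    · exact fun hy => ⟨y ^ (k⁻¹ : ℝ), ⟨Real.rpow_pos_of_pos hy.1 _,
        Real.rpow_lt_one hy.1.le hy.2 (by positivity)⟩, Real.rpow_inv_natCast_pow hy.1.le hk⟩
  have h := lintegral_image_eq_lintegral_abs_deriv_mul (s := Set.Ioo 0 1) (f := fun z : ℝ => z ^ k)
    (f' := fun z => k * z ^ (k - 1)) measurableSet_Ioo
    (fun z _ => (hasDerivAt_pow k z).hasDerivWithinAt)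
    (fun x hx y hy hxy => (pow_left_inj₀ hx.1.le hy.1.le hk).1 hxy) f
  rw [himg] at h
  rw [h]
  exact setLIntegral_congr_fun measurableSet_Ioo fun z hz => by
    rw [abs_of_pos (mul_pos (by positivity) (pow_pos hz.1 _))]

theorem setLIntegral_Ioo_comp_mul {z : ℝ} (hz : 0 < z) (f : ℝ → ENNReal) :
    ∫⁻ l in Set.Ioo 0 z, f l = ENNReal.ofReal z * ∫⁻ x in Set.Ioo (0 : ℝ) 1, f (x * z) := by
  have himg : (fun x : ℝ => x * z) '' Set.Ioo 0 1 = Set.Ioo 0 z := by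
    rw [Set.image_mul_right_Ioo _ _ hz]; simp
  have h := lintegral_image_eq_lintegral_abs_deriv_mul (s := Set.Ioo 0 1) (f := fun x : ℝ => x * z)
    (f' := fun _ => z) measurableSet_Ioo
    (fun x _ => by simpa using ((hasDerivAt_id x).mul_const z).hasDerivWithinAt)
    (fun x _ y _ hxy => mul_right_cancel₀ hz.ne' hxy) f
  rw [himg] at h
  rw [h, lintegral_const_mul' _ _ ENNReal.ofReal_ne_top, abs_of_pos hz]

theorem beta_natCast_one {n : ℕ} (hn : n ≠ 0) : beta n 1 = 1 / n := by
  have h : (n : ℝ) ≠ 0 := Nat.cast_ne_zero.2 hn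
  have : Real.Gamma n ≠ 0 := (Real.Gamma_pos_of_pos (by positivity)).ne'
  rw [beta, Real.Gamma_add_one h, Real.Gamma_one]
  field_simp

theorem rpow_natCast_div_two_eq_sqrt_pow {x : ℝ} (hx : 0 ≤ x) (m : ℕ) :
    x ^ ((m : ℝ) / 2) = √x ^ m := by
  rw [Real.rpow_div_two_eq_sqrt _ hx, Real.rpow_natCast]

/-- The law of `B₁ √B₂` for independent Beta variables `B₁` and `B₂`. -/
theorem lintegral_betaMeasure_prod_comp_mul_sqrt (m : ℕ) {g : ℝ → ENNReal} (hg : Measurable g) :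
    ∫⁻ p : ℝ × ℝ, g (p.1 * p.2 ^ (1 / 2 : ℝ)) ∂((betaMeasure ((m + 1 : ℕ) : ℝ) 1).prod
      (betaMeasure ((((m + 1 : ℕ) : ℝ) + 1) / 2) ((((m + 1 : ℕ) : ℝ) + 1) / 2))) =
    ENNReal.ofReal (2 * (m + 1 : ℕ) /
      beta ((((m + 1 : ℕ) : ℝ) + 1) / 2) ((((m + 1 : ℕ) : ℝ) + 1) / 2)) *
      ∫⁻ r in Set.Ioi (0 : ℝ), ENNReal.ofReal (r ^ m) * (g r *
        ∫⁻ t in Set.Ioc r 1, ENNReal.ofReal (√(1 - t ^ 2) ^ m)) := by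
  set n : ℝ := ((m + 1 : ℕ) : ℝ) with hn
  have hnm : n = m + 1 := by simp [hn]
  have hn0 : 0 < n := by rw [hnm]; positivity
  set α := (n + 1) / 2 with hα
  have hb : 0 < beta α α := beta_pos (by positivity) (by positivity)
  have := isProbabilityMeasureBeta hn0 one_pos
  have := isProbabilityMeasureBeta (α := α) (β := α) (by positivity) (by positivity)
  have hin (y : ℝ) : ∫⁻ x, g (x * y ^ (1 / 2 : ℝ)) ∂(betaMeasure n 1) =
      ∫⁻ x in Set.Ioo (0 : ℝ) 1, ENNReal.ofReal (n * x ^ m) * g (x * y ^ (1 / 2 : ℝ)) := by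
    rw [lintegral_betaMeasure _ _ (by fun_prop)]
    refine setLIntegral_congr_fun measurableSet_Ioo fun x hx => ?_
    simp only [sub_self, Real.rpow_zero, mul_one]
    rw [hn, beta_natCast_one (Nat.succ_ne_zero m), one_div_one_div, ← hn,
      show n - 1 = m by rw [hnm]; ring, Real.rpow_natCast]
  rw [lintegral_prod_symm _ (by fun_prop)]
  simp_rw [hin]
  have hmeas : Measurable fun y : ℝ =>
      ∫⁻ x in Set.Ioo (0 : ℝ) 1, ENNReal.ofReal (n * x ^ m) * g (x * y ^ (1 / 2 : ℝ)) :=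
    Measurable.lintegral_prod_right' (ν := volume.restrict (Set.Ioo (0 : ℝ) 1))
      (f := fun p : ℝ × ℝ => ENNReal.ofReal (n * p.2 ^ m) * g (p.2 * p.1 ^ (1 / 2 : ℝ)))
      (by fun_prop)
  rw [lintegral_betaMeasure _ _ hmeas, setLIntegral_Ioo_comp_pow two_ne_zero]
  have htri := lintegral_triangle (A := fun t => ENNReal.ofReal (√(1 - t ^ 2) ^ m))
    (B := fun r => ENNReal.ofReal (r ^ m) * g r) (by fun_prop) (by fun_prop)
  simp_rw [← mul_assoc] at htri ⊢
  rw [← htri, ← lintegral_const_mul' _ _ ENNReal.ofReal_ne_top]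
  refine setLIntegral_congr_fun measurableSet_Ioo fun z hz => ?_
  have hz0 := hz.1
  have h1z : 0 ≤ 1 - z ^ 2 := by nlinarith [hz.1, hz.2]
  have hroot : (z ^ 2) ^ (1 / 2 : ℝ) = z := by
    rw [← Real.sqrt_eq_rpow, Real.sqrt_sq hz0.le]
  simp only [hroot, Nat.cast_ofNat, Nat.add_one_sub_one, pow_one]
  -- With `l = x * z` the triangle side acquires `z * z ^ m`; the other side has the same power, `z`
  -- from the Jacobian of `y = z ^ 2` and `z ^ m` from the Beta weight.
  rw [setLIntegral_Ioo_comp_mul hz0]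
  have hin2 : ∫⁻ x in Set.Ioo (0 : ℝ) 1, ENNReal.ofReal ((x * z) ^ m) * g (x * z) =
      ENNReal.ofReal (z ^ m) * ∫⁻ x in Set.Ioo (0 : ℝ) 1, ENNReal.ofReal (x ^ m) * g (x * z) := by
    rw [← lintegral_const_mul' _ _ ENNReal.ofReal_ne_top]
    congr 1 with x
    rw [mul_pow, mul_comm (x ^ m), ENNReal.ofReal_mul (by positivity), mul_assoc]
  have hin3 : ∫⁻ x in Set.Ioo (0 : ℝ) 1, ENNReal.ofReal (n * x ^ m) * g (x * z) =
      ENNReal.ofReal n * ∫⁻ x in Set.Ioo (0 : ℝ) 1, ENNReal.ofReal (x ^ m) * g (x * z) := by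
    rw [← lintegral_const_mul' _ _ ENNReal.ofReal_ne_top]
    congr 1 with x
    rw [ENNReal.ofReal_mul hn0.le, mul_assoc]
  rw [hin2, hin3]
  simp only [← mul_assoc]
  congr 1
  have hα1 : α - 1 = (m : ℝ) / 2 := by rw [hα, hnm]; ring
  rw [hα1, rpow_natCast_div_two_eq_sqrt_pow h1z, rpow_natCast_div_two_eq_sqrt_pow (by positivity),
    Real.sqrt_sq hz0.le]
  rw [← ENNReal.ofReal_mul (by positivity), ← ENNReal.ofReal_mul (by positivity),
    ← ENNReal.ofReal_mul (by positivity), ← ENNReal.ofReal_mul (by positivity),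
    ← ENNReal.ofReal_mul (by positivity)]
  congr 1
  field_simp

/-- The explicit density in terms of Lebesgue integrals. -/
theorem ofReal_ballDistDensity (m : ℕ) {l : ℝ} (hl : l ∈ Set.Ioo (0 : ℝ) 1) :
    ENNReal.ofReal (ballDistDensity (m + 1) l) = ENNReal.ofReal (2 * (m + 1 : ℕ) /
      beta ((((m + 1 : ℕ) : ℝ) + 1) / 2) ((((m + 1 : ℕ) : ℝ) + 1) / 2)) *
      (ENNReal.ofReal (l ^ m) * ∫⁻ t in Set.Ioc l 1, ENNReal.ofReal (√(1 - t ^ 2) ^ m)) := by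
  have hl0 := hl.1
  have hb : 0 < beta ((((m + 1 : ℕ) : ℝ) + 1) / 2) ((((m + 1 : ℕ) : ℝ) + 1) / 2) :=
    beta_pos (by positivity) (by positivity)
  have hcont : Continuous fun t : ℝ => √(1 - t ^ 2) ^ m := by fun_prop
  rw [← ofReal_integral_eq_lintegral_ofReal (hcont.integrableOn_Ioc)
    (.of_forall fun t => by positivity), ← intervalIntegral.integral_of_le hl.2.le,
    ← ENNReal.ofReal_mul (by positivity), ← ENNReal.ofReal_mul (by positivity)]
  congr 1
  have hint : ∫ z in l..1, (1 - z ^ 2) ^ ((((m + 1 : ℕ) : ℝ) - 1) / 2) =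
      ∫ z in l..1, √(1 - z ^ 2) ^ m := by
    refine intervalIntegral.integral_congr fun z hz => ?_
    rw [Set.uIcc_of_le hl.2.le] at hz
    have : 0 ≤ 1 - z ^ 2 := by nlinarith [hz.1, hz.2]
    simp only [Nat.cast_add, Nat.cast_one, add_sub_cancel_right]
    exact rpow_natCast_div_two_eq_sqrt_pow this m
  have hpow : l ^ (((m + 1 : ℕ) : ℝ) - 1) = l ^ m := by
    rw [← Real.rpow_natCast]; congr 1; simp
  -- For `α = (n + 1) / 2`, `beta α α = Γ(α)^2 / Γ(n + 1)`, which is the normalisation in the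
  -- density.
  rw [ballDistDensity, hint, hpow, beta, add_halves, ← add_div]
  have : Real.Gamma ((((m + 1 : ℕ) : ℝ) + 1) / 2) ≠ 0 :=
    (Real.Gamma_pos_of_pos (by positivity)).ne'
  have : Real.Gamma (((m + 1 : ℕ) : ℝ) + 1) ≠ 0 := (Real.Gamma_pos_of_pos (by positivity)).ne'
  field_simp

/-- The law of `B₁ √B₂` has the density `ballDistDensity`. -/
theorem map_betaMeasure_prod_eq_withDensity (m : ℕ) :
    ((betaMeasure ((m + 1 : ℕ) : ℝ) 1).prod
      (betaMeasure ((((m + 1 : ℕ) : ℝ) + 1) / 2) ((((m + 1 : ℕ) : ℝ) + 1) / 2))).map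
        (fun p : ℝ × ℝ => p.1 * p.2 ^ (1 / 2 : ℝ)) =
    (volume.restrict (Set.Ioo (0 : ℝ) 1)).withDensity
      (fun l => ENNReal.ofReal (ballDistDensity (m + 1) l)) := by
  ext s hs
  have hg : Measurable (s.indicator (1 : ℝ → ENNReal)) := measurable_one.indicator hs
  have hint := measurable_setLIntegral_Ioc (fun t => ENNReal.ofReal (√(1 - t ^ 2) ^ m)) 1
  rw [← lintegral_indicator_one hs, lintegral_map hg (by fun_prop),
    lintegral_betaMeasure_prod_comp_mul_sqrt m hg, withDensity_apply _ hs,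
    Measure.restrict_restrict hs, Set.inter_comm,
    ← lintegral_const_mul' _ _ ENNReal.ofReal_ne_top,
    ← lintegral_indicator measurableSet_Ioi, ← lintegral_indicator (measurableSet_Ioo.inter hs)]
  congr 1 with l
  by_cases hl : l ∈ Set.Ioo (0 : ℝ) 1
  · rw [Set.indicator_of_mem (Set.mem_Ioi.2 hl.1)]
    by_cases h : l ∈ s
    · rw [Set.indicator_of_mem (Set.mem_inter hl h), ofReal_ballDistDensity m hl]
      simp [h]
    · simp [h]
  · rw [Set.indicator_of_notMem (s := Set.Ioo (0 : ℝ) 1 ∩ s) (fun h => hl h.1)]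
    by_cases h0 : 0 < l
    · have : 1 ≤ l := not_lt.1 fun h => hl ⟨h0, h⟩
      simp [Set.Ioc_eq_empty_of_le this]
    · exact Set.indicator_of_notMem h0 _

end BetaLaw

/-! ### Identification of the laws. -/

section Laws

/-- The law of the normalised distance between two independent uniform points of a ball is that of
`B₁ √B₂` for independent Beta variables `B₁` and `B₂`. -/
theorem hasLaw_dist_div (m : ℕ) {Ω : Type*} [MeasurableSpace Ω] (P : Measure Ω)
    [IsProbabilityMeasure P] {a : ℝ} (ha : 0 < a) (c : EuclideanSpace ℝ (Fin (m + 1)))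
    {X₁ X₂ : Ω → EuclideanSpace ℝ (Fin (m + 1))}
    (hX₁ : pdf.IsUniform X₁ (Metric.closedBall c a) P volume)
    (hX₂ : pdf.IsUniform X₂ (Metric.closedBall c a) P volume) (hind : IndepFun X₁ X₂ P) :
    HasLaw (fun ω => dist (X₁ ω) (X₂ ω) / (2 * a))
      (((betaMeasure ((m + 1 : ℕ) : ℝ) 1).prod
        (betaMeasure ((((m + 1 : ℕ) : ℝ) + 1) / 2) ((((m + 1 : ℕ) : ℝ) + 1) / 2))).map
          (fun p : ℝ × ℝ => p.1 * p.2 ^ (1 / 2 : ℝ))) P := by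
  -- Uniformity on a set of positive finite volume forces a.e. measurability, since otherwise
  -- `Measure.map` would be zero.
  have hpos : volume (Metric.closedBall c a) ≠ 0 := (Metric.measure_closedBall_pos _ _ ha).ne'
  have hfin : volume (Metric.closedBall c a) ≠ ⊤ := measure_closedBall_lt_top.ne
  have hm₁ := hX₁.aemeasurable hpos hfin
  have hm₂ := hX₂.aemeasurable hpos hfin
  have hm : AEMeasurable (fun ω => dist (X₁ ω) (X₂ ω) / (2 * a)) P := by fun_prop
  obtain ⟨k, hk⟩ := exists_lintegral_dist_div_eq (F := EuclideanSpace ℝ (Fin m)) (by simp)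
    P ha c hX₁ hX₂ hm₁ hm₂ hind
  have hβ := fun (g : ℝ → ENNReal) (hg : Measurable g) =>
    lintegral_betaMeasure_prod_comp_mul_sqrt m hg
  simp only [finrank_euclideanSpace_fin] at hk
  set k' := ENNReal.ofReal (2 * (m + 1 : ℕ) /
    beta ((((m + 1 : ℕ) : ℝ) + 1) / 2) ((((m + 1 : ℕ) : ℝ) + 1) / 2))
  set ν := (betaMeasure ((m + 1 : ℕ) : ℝ) 1).prod
    (betaMeasure ((((m + 1 : ℕ) : ℝ) + 1) / 2) ((((m + 1 : ℕ) : ℝ) + 1) / 2))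
  have := isProbabilityMeasureBeta (α := ((m + 1 : ℕ) : ℝ)) (by positivity) one_pos
  have := isProbabilityMeasureBeta (α := (((m + 1 : ℕ) : ℝ) + 1) / 2)
    (β := (((m + 1 : ℕ) : ℝ) + 1) / 2) (by positivity) (by positivity)
  have : IsProbabilityMeasure ν := inferInstanceAs (IsProbabilityMeasure (Measure.prod _ _))
  -- Testing both formulas on `g = 1` makes `k` and `k'` inverses of the same integral.
  have h1 := hk (fun _ => 1) measurable_const
  have h2 := hβ (fun _ => 1) measurable_const
  simp only [lintegral_const, measure_univ, mul_one] at h1 h2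
  have hkk : k = k' := by
    rw [ENNReal.eq_inv_of_mul_eq_one_left h1.symm, ENNReal.eq_inv_of_mul_eq_one_left h2.symm]
  refine ⟨hm, ?_⟩
  ext s hs
  have hg : Measurable (s.indicator (1 : ℝ → ENNReal)) := measurable_one.indicator hs
  rw [← lintegral_indicator_one hs, ← lintegral_indicator_one hs, lintegral_map' hg.aemeasurable hm,
    lintegral_map hg (by fun_prop), hk _ hg, hβ _ hg, hkk]

theorem ae_mem_Ioo_betaMeasure (α β : ℝ) : ∀ᵐ x ∂(betaMeasure α β), x ∈ Set.Ioo (0 : ℝ) 1 := by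
  have h := lintegral_betaMeasure α β (f := (Set.Ioo (0 : ℝ) 1)ᶜ.indicator 1)
    (measurable_one.indicator measurableSet_Ioo.compl)
  rw [lintegral_indicator_one measurableSet_Ioo.compl] at h
  rw [ae_iff]
  refine h.trans ((setLIntegral_congr_fun measurableSet_Ioo (g := fun _ => 0) fun x hx => ?_).trans
    (by simp))
  simp [hx]

/-- A power of a uniform variable is a Beta variable. -/
theorem hasLaw_rpow_of_isUniform {n : ℕ} (hn : n ≠ 0) {Ω : Type*} [MeasurableSpace Ω]
    {Q : Measure Ω} {U : Ω → ℝ} (hU : pdf.IsUniform U (Set.Ioo (0 : ℝ) 1) Q volume) :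
    HasLaw (fun ω => U ω ^ (1 / (n : ℝ))) (betaMeasure n 1) Q := by
  have hm : AEMeasurable U Q := hU.aemeasurable (by simp) (by simp)
  have hmap : Q.map U = volume.restrict (Set.Ioo (0 : ℝ) 1) := by
    rw [hU, ProbabilityTheory.cond]; simp
  refine ⟨by fun_prop, ?_⟩
  ext s hs
  have hg : Measurable (s.indicator (1 : ℝ → ENNReal)) := measurable_one.indicator hs
  rw [← lintegral_indicator_one hs, ← lintegral_indicator_one hs,
    lintegral_map' hg.aemeasurable (by fun_prop),
    ← lintegral_map' (f := fun u : ℝ => s.indicator (1 : ℝ → ENNReal) (u ^ (1 / (n : ℝ))))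
      (by fun_prop) hm, hmap, lintegral_betaMeasure _ _ hg, setLIntegral_Ioo_comp_pow hn]
  refine setLIntegral_congr_fun measurableSet_Ioo fun x hx => ?_
  have hroot : (x ^ n) ^ (1 / (n : ℝ)) = x := by
    rw [one_div, Real.pow_rpow_inv_natCast hx.1.le hn]
  have hpow : x ^ ((n : ℝ) - 1) = x ^ (n - 1) := by
    rw [← Nat.cast_pred (Nat.pos_of_ne_zero hn), Real.rpow_natCast]
  simp only [hroot, sub_self, Real.rpow_zero, mul_one]
  rw [beta_natCast_one hn, one_div_one_div, hpow]

end Laws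

/-! ### Complex moments of Beta variables. -/

section Moments

theorem toReal_betaPDF_smul_cpow {α β : ℝ} (hα : 0 < α) (hβ : 0 < β) (s : ℂ) :
    (fun x : ℝ => (betaPDF α β x).toReal • (x : ℂ) ^ s) = (Set.Ioo (0 : ℝ) 1).indicator
      (fun x : ℝ => ((1 / beta α β : ℝ) : ℂ) *
        ((x : ℂ) ^ ((α : ℂ) + s - 1) * (1 - (x : ℂ)) ^ ((β : ℂ) - 1))) := by
  ext x
  by_cases hx : x ∈ Set.Ioo (0 : ℝ) 1
  · have hx0 : (x : ℂ) ≠ 0 := Complex.ofReal_ne_zero.2 hx.1.ne'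
    have h1x : 0 ≤ 1 - x := by linarith [hx.2]
    rw [Set.indicator_of_mem hx, betaPDF, ENNReal.toReal_ofReal (betaPDFReal_pos hx.1 hx.2 hα hβ).le,
      betaPDFReal, if_pos ⟨hx.1, hx.2⟩, Complex.real_smul, Complex.ofReal_mul, Complex.ofReal_mul,
      Complex.ofReal_cpow hx.1.le, Complex.ofReal_cpow h1x,
      show (α : ℂ) + s - 1 = ((α - 1 : ℝ) : ℂ) + s by push_cast; ring, Complex.cpow_add _ _ hx0]
    push_cast
    ring
  · rw [Set.indicator_of_notMem hx, betaPDF_eq, if_neg (fun h => hx ⟨h.1, h.2⟩)]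
    simp

theorem integrable_cpow_betaMeasure_iff {α β : ℝ} (hα : 0 < α) (hβ : 0 < β) (s : ℂ) :
    Integrable (fun x : ℝ => (x : ℂ) ^ s) (betaMeasure α β) ↔
      IntegrableOn (fun x : ℝ => (x : ℂ) ^ ((α : ℂ) + s - 1) * (1 - (x : ℂ)) ^ ((β : ℂ) - 1))
        (Set.Ioo 0 1) := by
  have hb : beta α β ≠ 0 := (beta_pos hα hβ).ne'
  rw [betaMeasure, integrable_withDensity_iff_integrable_smul' (f := betaPDF α β)
    (measurable_betaPDFReal α β).ennreal_ofReal (.of_forall fun _ => ENNReal.ofReal_lt_top),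
    toReal_betaPDF_smul_cpow hα hβ, integrable_indicator_iff measurableSet_Ioo]
  exact integrable_const_mul_iff (by simp [hb]) _

theorem integrable_cpow_betaMeasure {α β : ℝ} (hα : 0 < α) (hβ : 0 < β) {s : ℂ}
    (hs : -α < s.re) : Integrable (fun x : ℝ => (x : ℂ) ^ s) (betaMeasure α β) := by
  rw [integrable_cpow_betaMeasure_iff hα hβ,
    ← intervalIntegrable_iff_integrableOn_Ioo_of_le zero_le_one]
  exact Complex.betaIntegral_convergent (by simp; linarith) (by simpa using hβ)

/-- For `β = 1` the integrand is the pure power `x ^ (α + s - 1)`, so the threshold at 0 is exact.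
-/
theorem integrable_cpow_betaMeasure_one_iff {α : ℝ} (hα : 0 < α) {s : ℂ} :
    Integrable (fun x : ℝ => (x : ℂ) ^ s) (betaMeasure α 1) ↔ -α < s.re := by
  refine ⟨fun h => ?_, integrable_cpow_betaMeasure hα one_pos⟩
  rw [integrable_cpow_betaMeasure_iff hα one_pos] at h
  simp only [Complex.ofReal_one, sub_self, Complex.cpow_zero, mul_one] at h
  have := (intervalIntegral.integrableOn_Ioo_cpow_iff one_pos).1 h
  simp at this
  linarith

/-- The moments of the Beta distribution. -/
theorem integral_cpow_betaMeasure {α β : ℝ} (hα : 0 < α) (hβ : 0 < β) {s : ℂ}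
    (hs : -α < s.re) : ∫ x : ℝ, (x : ℂ) ^ s ∂(betaMeasure α β) =
      Complex.Gamma (α + s) * Complex.Gamma (α + β) /
        (Complex.Gamma α * Complex.Gamma (α + s + β)) := by
  rw [betaMeasure, integral_withDensity_eq_integral_toReal_smul (f := betaPDF α β)
    (measurable_betaPDFReal α β).ennreal_ofReal (.of_forall fun _ => ENNReal.ofReal_lt_top),
    toReal_betaPDF_smul_cpow hα hβ, integral_indicator measurableSet_Ioo, integral_const_mul,
    ← integral_Ioc_eq_integral_Ioo, ← intervalIntegral.integral_of_le zero_le_one]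
  have hβ0 : Complex.Gamma β ≠ 0 := Complex.Gamma_ne_zero_of_re_pos (by simpa)
  have hα0 : Complex.Gamma α ≠ 0 := Complex.Gamma_ne_zero_of_re_pos (by simpa)
  have hαβ0 : Complex.Gamma (α + β) ≠ 0 :=
    Complex.Gamma_ne_zero_of_re_pos (by simp; linarith)
  have hs0 : Complex.Gamma (α + s + β) ≠ 0 :=
    Complex.Gamma_ne_zero_of_re_pos (by simp; linarith)
  have hB := Complex.betaIntegral_eq_Gamma_mul_div (α + s) β (by simp; linarith) (by simpa)
  rw [Complex.betaIntegral] at hB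
  rw [hB, beta]
  push_cast
  rw [← Complex.Gamma_ofReal, ← Complex.Gamma_ofReal, ← Complex.Gamma_ofReal, Complex.ofReal_add]
  field_simp

theorem mul_rpow_half_cpow {x y : ℝ} (hx : 0 < x) (hy : 0 < y) (s : ℂ) :
    ((x * y ^ (1 / 2 : ℝ) : ℝ) : ℂ) ^ s = (x : ℂ) ^ s * (y : ℂ) ^ (s / 2) := by
  rw [Complex.ofReal_mul, Complex.mul_cpow_ofReal_nonneg hx.le (by positivity),
    Complex.cpow_def_of_ne_zero (x := ((y ^ (1 / 2 : ℝ) : ℝ) : ℂ))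
      (Complex.ofReal_ne_zero.2 (by positivity)),
    Complex.cpow_def_of_ne_zero (x := (y : ℂ)) (Complex.ofReal_ne_zero.2 hy.ne'),
    ← Complex.ofReal_log (by positivity), ← Complex.ofReal_log hy.le, Real.log_rpow hy]
  push_cast
  ring_nf

theorem ae_mul_rpow_half_cpow (μ ν : Measure ℝ) [SFinite ν] (hμ : ∀ᵐ x ∂μ, 0 < x)
    (hν : ∀ᵐ x ∂ν, 0 < x) (s : ℂ) :
    (fun p : ℝ × ℝ => ((p.1 * p.2 ^ (1 / 2 : ℝ) : ℝ) : ℂ) ^ s) =ᵐ[μ.prod ν]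
      fun p => (p.1 : ℂ) ^ s * (p.2 : ℂ) ^ (s / 2) := by
  filter_upwards [Measure.quasiMeasurePreserving_fst.ae hμ,
    Measure.quasiMeasurePreserving_snd.ae hν] with p h1 h2
  exact mul_rpow_half_cpow h1 h2 s

/-- The moments of `B₁ √B₂` exist exactly when those of `B₁` do. -/
theorem integrable_betaMeasure_prod_cpow_iff {α γ : ℝ} (hα : 0 < α) (hγ : 0 < γ)
    (hαγ : α ≤ 2 * γ) (s : ℂ) :
    Integrable (fun p : ℝ × ℝ => ((p.1 * p.2 ^ (1 / 2 : ℝ) : ℝ) : ℂ) ^ s)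
      ((betaMeasure α 1).prod (betaMeasure γ γ)) ↔ -α < s.re := by
  have := isProbabilityMeasureBeta hα one_pos
  have := isProbabilityMeasureBeta hγ hγ
  have h1 := (ae_mem_Ioo_betaMeasure α 1).mono fun x hx => hx.1
  have h2 := (ae_mem_Ioo_betaMeasure γ γ).mono fun x hx => hx.1
  rw [integrable_congr (ae_mul_rpow_half_cpow _ _ h1 h2 s)]
  constructor
  -- By Fubini some section at a fixed `y > 0` is integrable, and there `y ^ (s / 2)` is a nonzero
  -- constant.
  · intro h
    obtain ⟨y, hy, hy0⟩ := (h.prod_left_ae.and h2).exists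
    rw [← integrable_cpow_betaMeasure_one_iff hα]
    refine (integrable_mul_const_iff (IsUnit.mk0 ((y : ℂ) ^ (s / 2)) ?_) _).1 hy
    simp [Complex.cpow_eq_zero_iff, hy0.ne']
  · intro hs
    refine (integrable_cpow_betaMeasure hα one_pos hs).mul_prod
      (g := fun y : ℝ => (y : ℂ) ^ (s / 2)) (integrable_cpow_betaMeasure hγ hγ ?_)
    -- Since `α ≤ 2 * γ`, the second factor imposes no further restriction on `s`.
    rw [show s / 2 = s / (2 : ℝ) by simp, Complex.div_ofReal_re]
    linarith

/-- The integral factorises; the first factor collapses to `α / (α + s)` by the recursion for Gamma.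
-/
theorem integral_betaMeasure_prod_cpow {α γ : ℝ} (hα : 0 < α) (hγ : 0 < γ) (hαγ : α ≤ 2 * γ)
    {s : ℂ} (hs : -α < s.re) :
    ∫ p : ℝ × ℝ, ((p.1 * p.2 ^ (1 / 2 : ℝ) : ℝ) : ℂ) ^ s
      ∂((betaMeasure α 1).prod (betaMeasure γ γ)) =
    α * Complex.Gamma (γ + s / 2) * Complex.Gamma (2 * γ) /
      ((α + s) * (Complex.Gamma γ * Complex.Gamma (2 * γ + s / 2))) := by
  have := isProbabilityMeasureBeta hα one_pos
  have := isProbabilityMeasureBeta hγ hγ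
  have h1 := (ae_mem_Ioo_betaMeasure α 1).mono fun x hx => hx.1
  have h2 := (ae_mem_Ioo_betaMeasure γ γ).mono fun x hx => hx.1
  have hs2 : -γ < (s / 2).re := by
    rw [show s / 2 = s / (2 : ℝ) by simp, Complex.div_ofReal_re]
    linarith
  have hαs : 0 < ((α : ℂ) + s).re := by simp; linarith
  have hαs0 : (α : ℂ) + s ≠ 0 := fun h => by simp [h] at hαs
  have hα0 : (α : ℂ) ≠ 0 := Complex.ofReal_ne_zero.2 hα.ne'
  have hg1 : Complex.Gamma (α + s) ≠ 0 := Complex.Gamma_ne_zero_of_re_pos hαs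
  have hg2 : Complex.Gamma α ≠ 0 := Complex.Gamma_ne_zero_of_re_pos (by simpa)
  rw [integral_congr_ae (ae_mul_rpow_half_cpow _ _ h1 h2 s),
    integral_prod_mul (fun x : ℝ => (x : ℂ) ^ s) (fun y : ℝ => (y : ℂ) ^ (s / 2)),
    integral_cpow_betaMeasure hα one_pos hs, integral_cpow_betaMeasure hγ hγ hs2,
    Complex.ofReal_one, Complex.Gamma_add_one _ hα0, Complex.Gamma_add_one _ hαs0,
    show (γ : ℂ) + s / 2 + γ = 2 * γ + s / 2 by ring, ← two_mul]
  field_simp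

end Moments

/-! ### Transfer to the distance, and Gamma identities. -/

section Distance

/-- Independence makes the joint law the product of the marginals, so every realisation of the pair
gives the same law. -/
theorem identDistrib_of_indepFun {Ω Ω' : Type*} [MeasurableSpace Ω] [MeasurableSpace Ω']
    {P : Measure Ω} {Q : Measure Ω'} [IsFiniteMeasure Q] {μ ν : Measure ℝ} {S : ℝ × ℝ → ℝ}
    (hS : Measurable S) {D : Ω → ℝ} {B₁ B₂ : Ω' → ℝ} (hD : HasLaw D ((μ.prod ν).map S) P)
    (h₁ : HasLaw B₁ μ Q) (h₂ : HasLaw B₂ ν Q) (h : IndepFun B₁ B₂ Q) :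
    IdentDistrib D (fun ω => S (B₁ ω, B₂ ω)) P Q := by
  have h3 := (indepFun_iff_hasLaw_prodMk_prod h₁ h₂).1 h
  have h4 : HasLaw S ((μ.prod ν).map S) (μ.prod ν) := ⟨hS.aemeasurable, rfl⟩
  have h5 := h4.fun_comp h3
  exact ⟨hD.aemeasurable, h5.aemeasurable, by rw [hD.map_eq, h5.map_eq]⟩

/-- Identities between the Gamma quotients for the moments. -/
theorem gamma_quotient_eq_of_neg_lt_re {n : ℕ} {s : ℂ} (hs : -(n : ℝ) < s.re) (C : ℂ) :
    C * Complex.Gamma ((n : ℂ) / 2 + s / 2 + 1 / 2) /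
        (((n : ℂ) + s) * Complex.Gamma ((n : ℂ) + s / 2 + 1)) =
      C * (Complex.Gamma (s + n) * Complex.Gamma (s / 2 + (n : ℂ) / 2 + 1 / 2)) /
        (Complex.Gamma (s + n + 1) * Complex.Gamma (s / 2 + n + 1)) := by
  have hre : 0 < (s + n).re := by simp; linarith
  have h0 : s + n ≠ 0 := fun h => by simp [h] at hre
  have hg : Complex.Gamma (s + n) ≠ 0 := Complex.Gamma_ne_zero_of_re_pos hre
  rw [Complex.Gamma_add_one _ h0, add_comm (n : ℂ) s, add_comm ((n : ℂ) / 2) (s / 2),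
    add_comm (n : ℂ) (s / 2)]
  field_simp

/-- Duplication at `(s + n + 1) / 2` trades `Γ((s + n + 1) / 2) / Γ(s + n + 1)` for `1 / Γ((s + n) /
2 + 1)`; the factor `2 ^ (-s)` it produces cancels `2 ^ s`. -/
theorem gamma_quotient_eq_duplication {n : ℕ} {s : ℂ} (hs : -(n : ℝ) < s.re) :
    (2 : ℂ) ^ s * (Complex.Gamma (s + n) * Complex.Gamma (s / 2 + (n : ℂ) / 2 + 1 / 2)) /
        (Complex.Gamma (s + n + 1) * Complex.Gamma (s / 2 + n + 1)) =
      ((Real.sqrt Real.pi * 2 ^ (-(n : ℝ)) : ℝ) : ℂ) * Complex.Gamma (s + n) /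
        (Complex.Gamma (s / 2 + (n : ℂ) / 2 + 1) * Complex.Gamma (s / 2 + n + 1)) := by
  have hre : 0 < (s + n).re := by simp; linarith
  have hre2 : 0 < ((s + n) / 2).re := by
    rw [show (s + n) / 2 = (s + n) / (2 : ℝ) by simp, Complex.div_ofReal_re]; linarith
  have h1 : Complex.Gamma (s + n + 1) ≠ 0 :=
    Complex.Gamma_ne_zero_of_re_pos (by rw [Complex.add_re, Complex.one_re]; linarith)
  have h2 : Complex.Gamma (s / 2 + (n : ℂ) / 2 + 1) ≠ 0 :=
    Complex.Gamma_ne_zero_of_re_pos (by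
      rw [← add_div, Complex.add_re, Complex.one_re]; linarith)
  have hdup := Complex.Gamma_mul_Gamma_add_half (s / 2 + (n : ℂ) / 2 + 1 / 2)
  rw [show s / 2 + (n : ℂ) / 2 + 1 / 2 + 1 / 2 = s / 2 + (n : ℂ) / 2 + 1 by ring,
    show 2 * (s / 2 + (n : ℂ) / 2 + 1 / 2) = s + n + 1 by ring,
    show 1 - (s + n + 1) = -s + -(n : ℂ) by ring, Complex.cpow_add _ _ two_ne_zero] at hdup
  have h2s : (2 : ℂ) ^ s * (2 : ℂ) ^ (-s) = 1 := by
    rw [← Complex.cpow_add _ _ two_ne_zero]; simp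
  have hn2 : ((2 ^ (-(n : ℝ)) : ℝ) : ℂ) = (2 : ℂ) ^ (-(n : ℂ)) := by
    rw [Complex.ofReal_cpow zero_le_two]; simp
  have key : (2 : ℂ) ^ s * Complex.Gamma (s / 2 + (n : ℂ) / 2 + 1 / 2) *
      Complex.Gamma (s / 2 + (n : ℂ) / 2 + 1) =
      ((Real.sqrt Real.pi * 2 ^ (-(n : ℝ)) : ℝ) : ℂ) * Complex.Gamma (s + n + 1) := by
    rw [Complex.ofReal_mul, hn2, mul_assoc, hdup]
    linear_combination (Complex.Gamma (s + n + 1) * (2 : ℂ) ^ (-(n : ℂ)) * (√Real.pi : ℂ)) * h2s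
  rw [mul_comm (Complex.Gamma (s + n + 1)), mul_comm (Complex.Gamma (s / 2 + (n : ℂ) / 2 + 1)),
    ← div_div, ← div_div, div_eq_div_iff h1 h2, div_mul_eq_mul_div, div_mul_eq_mul_div]
  congr 1
  linear_combination (Complex.Gamma (s + n)) * key

/-- The natural moments, from the complex ones. -/
theorem integral_pow_eq_of_cpow {Ω : Type*} [MeasurableSpace Ω] {P : Measure Ω} {n : ℕ} {a : ℝ}
    {D : Ω → ℝ}
    (h : ∀ s : ℂ, -(n : ℝ) < s.re → ∫ ω, (D ω : ℂ) ^ s ∂P =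
      ((2 * a : ℝ) : ℂ) ^ s * ((ballDistConst n : ℂ) *
        Complex.Gamma ((n : ℂ) / 2 + s / 2 + 1 / 2) /
          (((n : ℂ) + s) * Complex.Gamma ((n : ℂ) + s / 2 + 1)))) {k : ℕ} (hk : k ≠ 0) :
    ∫ ω, D ω ^ k ∂P = (2 * a) ^ k * (ballDistConst n *
      Real.Gamma ((n : ℝ) / 2 + k / 2 + 1 / 2) / ((n + k) * Real.Gamma ((n : ℝ) + k / 2 + 1))) := by
  have hk0 : (0 : ℝ) < k := by positivity
  have hn0 : (0 : ℝ) ≤ n := by positivity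
  have hk' := h k (by simp; linarith)
  simp only [Complex.cpow_natCast] at hk'
  rw [← Complex.ofReal_inj, ← integral_complex_ofReal]
  push_cast [← Complex.Gamma_ofReal] at hk' ⊢
  exact hk'

theorem ballDistConst_two : ballDistConst 2 = 8 / √Real.pi := by
  have h : Real.Gamma ((2 : ℕ) / 2 + 1 / 2 : ℝ) = √Real.pi / 2 := by
    rw [show ((2 : ℕ) / 2 + 1 / 2 : ℝ) = 1 / 2 + 1 by norm_num, Real.Gamma_add_one (by norm_num),
      Real.Gamma_one_half_eq]
    ring
  rw [ballDistConst, h, Real.Gamma_nat_eq_factorial]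
  have : √Real.pi ≠ 0 := by positivity
  norm_num [Nat.factorial]
  field_simp
  norm_num

theorem ballDistConst_one : ballDistConst 1 = 1 := by
  rw [ballDistConst, Real.Gamma_nat_eq_factorial]
  norm_num [Real.Gamma_one]

theorem ballDistConst_three : ballDistConst 3 = 18 := by
  rw [ballDistConst, Real.Gamma_nat_eq_factorial]
  norm_num [Real.Gamma_two, Nat.factorial]

/-- At order 2 both Gamma arguments move by exactly 1, leaving `((n + 1) / 2) / (n + 1) = 1 / 2`. -/
theorem ballDistConst_mul_second_moment {n : ℕ} :
    ballDistConst n * Real.Gamma ((n : ℝ) / 2 + (2 : ℕ) / 2 + 1 / 2) /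
      ((n + (2 : ℕ)) * Real.Gamma ((n : ℝ) + (2 : ℕ) / 2 + 1)) = n / (2 * (n + 2)) := by
  have hn0 : (0 : ℝ) ≤ n := by positivity
  rw [ballDistConst, show (n : ℝ) / 2 + (2 : ℕ) / 2 + 1 / 2 = n / 2 + 1 / 2 + 1 by push_cast; ring,
    show (n : ℝ) + (2 : ℕ) / 2 + 1 = n + 1 + 1 by push_cast; ring,
    Real.Gamma_add_one (s := (n : ℝ) / 2 + 1 / 2) (by positivity),
    Real.Gamma_add_one (s := (n : ℝ) + 1) (by positivity)]
  have h1 : Real.Gamma ((n : ℝ) / 2 + 1 / 2) ≠ 0 := (Real.Gamma_pos_of_pos (by positivity)).ne'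
  have h2 : Real.Gamma ((n : ℝ) + 1) ≠ 0 := (Real.Gamma_pos_of_pos (by positivity)).ne'
  push_cast
  field_simp

end Distance

/-! ### Assembly of the theorem. -/

theorem mainTheorem6 {Ω : Type*} [MeasurableSpace Ω] (P : Measure Ω) [IsProbabilityMeasure P]
    (n : ℕ) (hn : 1 ≤ n) (a : ℝ) (ha : 0 < a) (c : EuclideanSpace ℝ (Fin n))
    (X₁ X₂ : Ω → EuclideanSpace ℝ (Fin n))
    (hX₁ : pdf.IsUniform X₁ (Metric.closedBall c a) P volume)
    (hX₂ : pdf.IsUniform X₂ (Metric.closedBall c a) P volume)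
    (hind : IndepFun X₁ X₂ P)
    (D : Ω → ℝ) (hD : ∀ ω, D ω = dist (X₁ ω) (X₂ ω)) :
    -- the density of `D / (2a)`
    HasLaw (fun ω => D ω / (2 * a))
      ((volume.restrict (Set.Ioo (0 : ℝ) 1)).withDensity
        (fun l => ENNReal.ofReal (ballDistDensity n l))) P ∧
    -- the moment of order `s` exists exactly for `Re s > -n`
    (∀ s : ℂ, Integrable (fun ω => (D ω : ℂ) ^ s) P ↔ -(n : ℝ) < s.re) ∧
    -- the moments
    (∀ s : ℂ, -(n : ℝ) < s.re →
      ∫ ω, ((D ω / (2 * a) : ℝ) : ℂ) ^ s ∂P =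
        (ballDistConst n : ℂ) * Complex.Gamma ((n : ℂ) / 2 + s / 2 + 1 / 2) /
          (((n : ℂ) + s) * Complex.Gamma ((n : ℂ) + s / 2 + 1)) ∧
      ∫ ω, (D ω : ℂ) ^ s ∂P =
        (ballDistConst n : ℂ) * ((2 * a : ℝ) : ℂ) ^ s *
          (Complex.Gamma (s + n) * Complex.Gamma (s / 2 + (n : ℂ) / 2 + 1 / 2)) /
          (Complex.Gamma (s + n + 1) * Complex.Gamma (s / 2 + n + 1)) ∧
      ∫ ω, (D ω : ℂ) ^ s ∂P =
        ((Real.sqrt Real.pi * 2 ^ (-(n : ℝ)) * ballDistConst n : ℝ) : ℂ) * (a : ℂ) ^ s *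
          Complex.Gamma (s + n) /
          (Complex.Gamma (s / 2 + (n : ℂ) / 2 + 1) * Complex.Gamma (s / 2 + n + 1))) ∧
    -- the factorisation with independent Beta variables
    (∀ {Ω' : Type*} [MeasurableSpace Ω'] (Q : Measure Ω') [IsProbabilityMeasure Q]
      (B₁ B₂ : Ω' → ℝ),
      HasLaw B₁ (betaMeasure n 1) Q →
      HasLaw B₂ (betaMeasure (((n : ℝ) + 1) / 2) (((n : ℝ) + 1) / 2)) Q →
      IndepFun B₁ B₂ Q →
      IdentDistrib D (fun ω => 2 * a * B₁ ω * B₂ ω ^ (1 / 2 : ℝ)) P Q) ∧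
    -- the same with a uniform variable in place of the first Beta variable
    (∀ {Ω' : Type*} [MeasurableSpace Ω'] (Q : Measure Ω') [IsProbabilityMeasure Q]
      (U B₂ : Ω' → ℝ),
      pdf.IsUniform U (Set.Ioo (0 : ℝ) 1) Q volume →
      HasLaw B₂ (betaMeasure (((n : ℝ) + 1) / 2) (((n : ℝ) + 1) / 2)) Q →
      IndepFun U B₂ Q →
      IdentDistrib D (fun ω => 2 * a * U ω ^ (1 / (n : ℝ)) * B₂ ω ^ (1 / 2 : ℝ)) P Q) ∧
    -- special cases
    (n = 2 → ∫ ω, D ω ∂P = 128 / (45 * Real.pi) * a) ∧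
    (n = 1 → a = 1 / 2 → ∫ ω, D ω ∂P = 1 / 3 ∧ ∫ ω, D ω ^ 2 ∂P = 1 / 6) ∧
    (n = 2 → a = 1 / 2 → ∫ ω, D ω ∂P = 64 / (45 * Real.pi) ∧ ∫ ω, D ω ^ 2 ∂P = 1 / 4) ∧
    (n = 3 → a = 1 / 2 → ∫ ω, D ω ∂P = 18 / 35 ∧ ∫ ω, D ω ^ 2 ∂P = 3 / 10) ∧
    ∫ ω, D ω ^ 2 ∂P = 2 * a ^ 2 * n / (n + 2) := by
  have hL : HasLaw (fun ω => D ω / (2 * a)) (((betaMeasure n 1).prod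
      (betaMeasure (((n : ℝ) + 1) / 2) (((n : ℝ) + 1) / 2))).map
        (fun p : ℝ × ℝ => p.1 * p.2 ^ (1 / 2 : ℝ))) P := by
    -- Here `m` is the dimension of the slices.
    obtain ⟨m, rfl⟩ : ∃ m, n = m + 1 := ⟨n - 1, by omega⟩
    simp_rw [hD]
    exact hasLaw_dist_div m P ha c hX₁ hX₂ hind
  have hdens : ((betaMeasure n 1).prod
      (betaMeasure (((n : ℝ) + 1) / 2) (((n : ℝ) + 1) / 2))).map
        (fun p : ℝ × ℝ => p.1 * p.2 ^ (1 / 2 : ℝ)) = (volume.restrict (Set.Ioo (0 : ℝ) 1)).withDensity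
      (fun l => ENNReal.ofReal (ballDistDensity n l)) := by
    obtain ⟨m, rfl⟩ : ∃ m, n = m + 1 := ⟨n - 1, by omega⟩
    exact map_betaMeasure_prod_eq_withDensity m
  set γ : ℝ := ((n : ℝ) + 1) / 2 with hγ
  have hn0 : (0 : ℝ) < n := by exact_mod_cast hn
  have hγ0 : 0 < γ := by positivity
  have hnγ : (n : ℝ) ≤ 2 * γ := by rw [hγ]; linarith
  have h2a : 0 < 2 * a := by positivity
  set ν := (betaMeasure n 1).prod (betaMeasure γ γ)
  set T : ℝ × ℝ → ℝ := fun p => p.1 * p.2 ^ (1 / 2 : ℝ) with hT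
  have hTm : Measurable T := by fun_prop
  have := isProbabilityMeasureBeta hn0 one_pos
  have := isProbabilityMeasureBeta hγ0 hγ0
  have hcm (s : ℂ) : Measurable fun x : ℝ => (x : ℂ) ^ s := by fun_prop
  have hscale (s : ℂ) : (fun ω => (D ω : ℂ) ^ s) =
      fun ω => ((2 * a : ℝ) : ℂ) ^ s * ((D ω / (2 * a) : ℝ) : ℂ) ^ s := by
    ext ω
    rw [← Complex.mul_cpow_ofReal_nonneg h2a.le (div_nonneg (by rw [hD]; exact dist_nonneg) h2a.le),
      ← Complex.ofReal_mul, mul_div_cancel₀ _ h2a.ne']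
  have hmom (s : ℂ) (hs : -(n : ℝ) < s.re) : ∫ ω, ((D ω / (2 * a) : ℝ) : ℂ) ^ s ∂P =
      (ballDistConst n : ℂ) * Complex.Gamma ((n : ℂ) / 2 + s / 2 + 1 / 2) /
        (((n : ℂ) + s) * Complex.Gamma ((n : ℂ) + s / 2 + 1)) := by
    have h1 := hL.integral_comp (f := fun x : ℝ => (x : ℂ) ^ s) (hcm s).aestronglyMeasurable
    rw [integral_map hTm.aemeasurable (hcm s).aestronglyMeasurable] at h1
    refine h1.trans ?_
    rw [integral_betaMeasure_prod_cpow hn0 hγ0 hnγ hs, ballDistConst]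
    push_cast [hγ, ← Complex.Gamma_ofReal]
    rw [show ((n : ℂ) + 1) / 2 + s / 2 = (n : ℂ) / 2 + s / 2 + 1 / 2 by ring,
      show 2 * (((n : ℂ) + 1) / 2) = n + 1 by ring,
      show ((n : ℂ) + 1) / 2 = (n : ℂ) / 2 + 1 / 2 by ring,
      show (n : ℂ) + 1 + s / 2 = n + s / 2 + 1 by ring, ← div_div]
    simp only [div_eq_mul_inv, mul_inv]
    ring
  have hmomD (s : ℂ) (hs : -(n : ℝ) < s.re) : ∫ ω, (D ω : ℂ) ^ s ∂P =
      ((2 * a : ℝ) : ℂ) ^ s * ((ballDistConst n : ℂ) *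
        Complex.Gamma ((n : ℂ) / 2 + s / 2 + 1 / 2) /
          (((n : ℂ) + s) * Complex.Gamma ((n : ℂ) + s / 2 + 1))) := by
    rw [hscale, integral_const_mul, hmom s hs]
  have hD2 : (fun ω => 2 * a * (D ω / (2 * a))) = D := by
    ext ω; exact mul_div_cancel₀ _ h2a.ne'
  have hDlaw : HasLaw D (ν.map (fun p => 2 * a * T p)) P := by
    have h : HasLaw (fun x : ℝ => 2 * a * x) (ν.map (fun p => 2 * a * T p)) (ν.map T) :=
      ⟨by fun_prop, by rw [Measure.map_map (by fun_prop) hTm]; rfl⟩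
    have h' := h.fun_comp hL
    rwa [hD2] at h'
  have hpow {k : ℕ} (hk : k ≠ 0) := integral_pow_eq_of_cpow hmomD hk
  have hsecond : ∫ ω, D ω ^ 2 ∂P = 2 * a ^ 2 * n / (n + 2) := by
    rw [hpow two_ne_zero, ballDistConst_mul_second_moment]
    field_simp
  have hfirst := hpow one_ne_zero
  simp only [pow_one] at hfirst
  have htwo (h2 : n = 2) : ∫ ω, D ω ∂P = 128 / (45 * Real.pi) * a := by
    rw [hfirst, h2, ballDistConst_two,
      show ((2 : ℕ) / 2 + (1 : ℕ) / 2 + 1 / 2 : ℝ) = 2 by norm_num, Real.Gamma_two,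
      -- `Γ(7/2)` descends to `Γ(1/2) = √π`, which combines with the `√π` in `C` to give `π`.
      show ((2 : ℕ) + (1 : ℕ) / 2 + 1 : ℝ) = 1 / 2 + 1 + 1 + 1 by norm_num,
      Real.Gamma_add_one (by norm_num), Real.Gamma_add_one (by norm_num),
      Real.Gamma_add_one (by norm_num), Real.Gamma_one_half_eq]
    have hpi : √Real.pi ^ 2 = Real.pi := Real.sq_sqrt Real.pi_pos.le
    have : √Real.pi ≠ 0 := by positivity
    push_cast
    field_simp
    rw [hpi]
    ring
  refine ⟨?_, ?_, ?_, ?_, ?_, htwo, ?_, ?_, ?_, hsecond⟩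
  · rw [← hdens]
    exact hL
  · intro s
    rw [hscale, integrable_const_mul_iff (IsUnit.mk0 _ (by simp [Complex.cpow_eq_zero_iff, ha.ne'])),
      ← integrable_betaMeasure_prod_cpow_iff hn0 hγ0 hnγ s]
    change Integrable ((fun x : ℝ => (x : ℂ) ^ s) ∘ fun ω => D ω / (2 * a)) P ↔
      Integrable ((fun x : ℝ => (x : ℂ) ^ s) ∘ T) ν
    rw [← integrable_map_measure (hcm s).aestronglyMeasurable hL.aemeasurable, hL.map_eq,
      integrable_map_measure (hcm s).aestronglyMeasurable hTm.aemeasurable]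
  · intro s hs
    have h2 : ∫ ω, (D ω : ℂ) ^ s ∂P = (ballDistConst n : ℂ) * ((2 * a : ℝ) : ℂ) ^ s *
          (Complex.Gamma (s + n) * Complex.Gamma (s / 2 + (n : ℂ) / 2 + 1 / 2)) /
          (Complex.Gamma (s + n + 1) * Complex.Gamma (s / 2 + n + 1)) := by
      rw [hmomD s hs, gamma_quotient_eq_of_neg_lt_re hs]
      ring
    refine ⟨hmom s hs, h2, h2.trans ?_⟩
    have h3 := gamma_quotient_eq_duplication hs
    rw [Complex.ofReal_mul 2 a, Complex.ofReal_ofNat,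
      show (2 : ℂ) = ((2 : ℝ) : ℂ) by simp, Complex.mul_cpow_ofReal_nonneg zero_le_two ha.le,
      show ((2 : ℝ) : ℂ) = 2 by simp]
    rw [Complex.ofReal_mul (_ * _) (ballDistConst n)]
    linear_combination ((ballDistConst n : ℂ) * (a : ℂ) ^ s) * h3
  · intro Ω' _ Q _ B₁ B₂ h₁ h₂ h
    have h3 := identDistrib_of_indepFun (by fun_prop) hDlaw h₁ h₂ h
    simpa only [hT, ← mul_assoc] using h3
  · intro Ω' _ Q _ U B₂ hU h₂ h
    have h3 := identDistrib_of_indepFun (by fun_prop) hDlaw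
      (hasLaw_rpow_of_isUniform (by omega) hU) h₂
      (h.comp (φ := fun u : ℝ => u ^ (1 / (n : ℝ))) (ψ := id) (by fun_prop) measurable_id)
    simpa only [hT, ← mul_assoc] using h3
  · intro h1 ha2
    rw [hsecond, hfirst, h1, ha2, ballDistConst_one,
      -- The denominator's argument is the numerator's plus 1, so the Gamma values cancel
      -- unevaluated.
      show ((1 : ℕ) + (1 : ℕ) / 2 + 1 : ℝ) = (1 : ℕ) / 2 + (1 : ℕ) / 2 + 1 / 2 + 1 by norm_num,
      Real.Gamma_add_one (by norm_num)]
    have : Real.Gamma ((1 : ℕ) / 2 + (1 : ℕ) / 2 + 1 / 2 : ℝ) ≠ 0 :=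
      (Real.Gamma_pos_of_pos (by norm_num)).ne'
    refine ⟨?_, by norm_num⟩
    field_simp
    norm_num
  · intro h2 ha2
    rw [hsecond, htwo h2, h2, ha2]
    refine ⟨?_, by norm_num⟩
    ring
  · intro h3 ha2
    rw [hsecond, hfirst, h3, ha2, ballDistConst_three,
      -- Here the arguments `9/2` and `5/2` differ by 2, and the same cancellation works.
      show ((3 : ℕ) + (1 : ℕ) / 2 + 1 : ℝ) = (3 : ℕ) / 2 + (1 : ℕ) / 2 + 1 / 2 + 1 + 1 by norm_num,
      Real.Gamma_add_one (by norm_num), Real.Gamma_add_one (by norm_num)]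
    have : Real.Gamma ((3 : ℕ) / 2 + (1 : ℕ) / 2 + 1 / 2 : ℝ) ≠ 0 :=
      (Real.Gamma_pos_of_pos (by norm_num)).ne'
    refine ⟨?_, by norm_num⟩
    field_simp
    norm_num
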